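/- **Setting.** Let $G=(V,E)$ be a finite undirected multigraph with $m=|E|\ge 2$ edges, let $\phi,Z>0$, put $c=\frac{1}{\phi Z}$, and let $d\ge 2$ be a power of $2$ (the algorithm is used with $Z=\Theta(\log m)$ and $d=\Theta(\log m)$). Let $G_E$ be the subdivision graph, obtained by splitting every edge $e$ by a split node $x_e$; $X_E=\{x_e: e\in E\}$, and $G_E[A]$ is the subgraph induced by $A\subseteq V\cup X_E$. The cut-matching algorithm keeps a set $A_t\subseteq V\cup X_E$, its complement $R_t$, and a matrix $F_t\in\mathbb R^{m\times m}$ indexed by $X_E$; initially $A_0=V\cup X_E$ and $F_0=I$. For $A_t$ put $$\Delta_t=I_{A_t}-\tfrac{1}{k_t}\mathbf 1_{A_t}\mathbf 1_{A_t}',\quad k_t=|A_t\cap X_E|,\qquad W_t=(\Delta_tF_t\Delta_t)^d,\qquad \psi(t)=\operatorname{tr}(W_t^2),$$ where $I_{A_t}$ and $\mathbf 1_{A_t}$ are the diagonal $0/1$ matrix and the indicator vector of $A_t\cap X_E$ (and $\Delta_t=0$ if $k_t=0$). As long as $\mathrm{vol}_{G_E}(R_t)\le\frac{m}{1500Z}$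 and fewer than $T$ rounds have been made, a further round is made: 1. A unit vector $r\in\mathbb R^m$ is drawn uniformly at random, independently of the past; $u_e=\langle W_t(x_e),r\rangle$, where $W_t(x_e)$ is row $x_e$ of $W_t$. 2. The cut player chooses disjoint sets $A^l,A^r\subseteq A_t\cap X_E$ and a number $\eta$ such that $\eta$ separates the values of $u$ on $A^l$ from those on $A^r$ (in one of the two orders), $|A^r|\ge k_t/2$, $|A^l|\le k_t/8$, $(u_e-\eta)^2\ge\frac19u_e^2$ for all $x_e\in A^l$, and $\sum_{x_e\in A^l}u_e^2\ge\frac1{80}\sum_{x_e\in A_t\cap X_E}u_e^2$. 3. The matching player returns a set $S\subseteq A_t$ that is empty or has conductance $\Phi_{G_E[A_t]}(S)\le\frac{50}{c}$, and a matching $M_{t+1}$ of all of $A^l\setminus S$ to distinct nodes of $A^r\setminus S$ whose pairs are joined by paths in $G_E[A_t\setminus S]$, each edge lying on at most $c$ of the paths (counted with multiplicity). 4. $A_{t+1}=A_t\setminus S$, $N_{t+1}=\frac{d-1}{d}I+\frac1dM_{t+1}$ and $F_{t+1}=N_{t+1}F_tN_{t+1}$, where $M_{t+1}$ is read as the $0/1$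 adjacency matrix of the matching, with a diagonal $1$ for each unmatched split node. The two players may use any rules, adaptive or randomised, that obey these specifications. **Claim (Total Potential).** After $T=\Theta(\log^2m)$ rounds, with high probability over the random vectors, $\psi(T)\le m^{-\Omega(1)}$. Precisely: for all constants $\ell,p>0$ there is a constant $C>0$, depending only on $\ell$ and $p$, such that for all $G,\phi,Z,d$ as above, all players, and every integer $T\ge C\log^2m$, with probability at least $1-m^{-p}$ the following holds: if the algorithm makes all $T$ rounds, then $$\psi(T)\le\frac{1}{m^{\ell}} .$$ -/

import Mathlib

namespace CutMatching

open MeasureTheory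

/-- A finite undirected multigraph (parallel edges and self-loops are allowed) with vertex type `V`
and edge type `E`: the edge `e` joins `src e` and `tgt e`. The orientation carries no meaning. -/
structure Multigraph (V : Type*) (E : Type*) where
  src : E → V
  tgt : E → V

namespace Multigraph

variable {V E : Type*}

/-- `G.IsWalk u p v`: the list of edges `p`, each traversed in either direction,
leads from `u` to `v`. -/
def IsWalk (G : Multigraph V E) : V → List E → V → Prop
  | u, [], v => u = v
  | u, e :: p, v =>
      (G.src e = u ∧ G.IsWalk (G.tgt e) p v) ∨ (G.tgt e = u ∧ G.IsWalk (G.src e) p v)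

/-- The subdivision graph `G_E`: its vertices are the regular nodes `Sum.inl v` and the split nodes
`x_e = Sum.inr e`; every edge `e` is replaced by two edges, joining `x_e` to the two ends
of `e`. -/
def subdivision (G : Multigraph V E) : Multigraph (V ⊕ E) (E × Bool) where
  src := fun i => Sum.inl (if i.2 then G.tgt i.1 else G.src i.1)
  tgt := fun i => Sum.inr i.1

variable [DecidableEq V] [Fintype E]

/-- The edges of the induced subgraph `G[A]`. -/
def edgesIn (G : Multigraph V E) (A : Finset V) : Finset E :=
  Finset.univ.filter fun e => G.src e ∈ A ∧ G.tgt e ∈ A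

/-- The volume of `S` in `G[A]`: the sum over `S` of the degrees in `G[A]`, counted edge by edge
(a self-loop contributes two to the degree of its vertex). -/
def volIn (G : Multigraph V E) (A S : Finset V) : ℕ :=
  ∑ e ∈ G.edgesIn A, ((if G.src e ∈ S then 1 else 0) + (if G.tgt e ∈ S then 1 else 0))

/-- The volume of `S` in `G`. -/
def vol [Fintype V] (G : Multigraph V E) (S : Finset V) : ℕ :=
  G.volIn Finset.univ S

/-- The edges of `G[A]` with exactly one end in `S`. -/
def cutIn (G : Multigraph V E) (A S : Finset V) : Finset E :=
  (G.edgesIn A).filter fun e => ¬ (G.src e ∈ S ↔ G.tgt e ∈ S)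

/-- The conductance of the cut `(S, A \ S)` in `G[A]`. (A crossing edge contributes to the volume
of both sides, so the denominator vanishes only if there is no crossing edge; the value
is then `0`.) -/
noncomputable def conductanceIn (G : Multigraph V E) (A S : Finset V) : ℝ :=
  ((G.cutIn A S).card : ℝ) / min (G.volIn A S : ℝ) (G.volIn A (A \ S) : ℝ)

end Multigraph

section Matrices

variable {E : Type*} [Fintype E] [DecidableEq E]

/-- `I_A - (1/|A|) 1_A 1_A'`. It is the zero matrix if `A` is empty. -/
noncomputable def Delta (A : Finset E) : Matrix E E ℝ :=
  Matrix.of fun i j =>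
    (if i = j ∧ i ∈ A then 1 else 0) - (if i ∈ A ∧ j ∈ A then 1 / (A.card : ℝ) else 0)

/-- The `0/1` matrix of a matching. A matching on the split nodes is given by the involution `σ`
that exchanges matched nodes and fixes the unmatched ones; unmatched nodes get a diagonal `1`. -/
def matchingMatrix (σ : Equiv.Perm E) : Matrix E E ℝ :=
  Matrix.of fun i j => if σ i = j then 1 else 0

/-- `N = ((d-1)/d) I + (1/d) M`. -/
noncomputable def lazyMatrix (d : ℕ) (σ : Equiv.Perm E) : Matrix E E ℝ :=
  (((d : ℝ) - 1) / d) • (1 : Matrix E E ℝ) + (1 / (d : ℝ)) • matchingMatrix σ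

/-- The flow matrix after `t` rounds, where `σ s` is the matching found in the round leading from
state `s` to state `s + 1`: `F_0 = I` and `F_{t+1} = N_{t+1} F_t N_{t+1}`. -/
noncomputable def flowMatrix (d : ℕ) (σ : ℕ → Equiv.Perm E) : ℕ → Matrix E E ℝ
  | 0 => 1
  | t + 1 => lazyMatrix d (σ t) * flowMatrix d σ t * lazyMatrix d (σ t)

/-- `W = (Δ_A F Δ_A)^d`, where `A` is the set of remaining split nodes. -/
noncomputable def walkMatrix (d : ℕ) (A : Finset E) (F : Matrix E E ℝ) : Matrix E E ℝ :=
  (Delta A * F * Delta A) ^ d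

/-- The potential `tr (W ^ 2)`. -/
noncomputable def potential (d : ℕ) (A : Finset E) (F : Matrix E E ℝ) : ℝ :=
  ((walkMatrix d A F) ^ 2).trace

end Matrices

/-- The uniform probability distribution on the unit sphere of `ℝ^E`. -/
noncomputable def sphereUniform (E : Type*) [Fintype E] :
    Measure (Metric.sphere (0 : EuclideanSpace ℝ E) 1) :=
  ((volume : Measure (EuclideanSpace ℝ E)).toSphere Set.univ)⁻¹ •
    (volume : Measure (EuclideanSpace ℝ E)).toSphere

/-- The cut player: from the values `u e` on the remaining split nodes `X` it forms the source set
`Al` and the target set `Ar`, separated by some value `η`. -/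
def IsCutPlayerChoice {E : Type*} [DecidableEq E] (X : Finset E) (u : E → ℝ)
    (Al Ar : Finset E) : Prop :=
  Al ⊆ X ∧ Ar ⊆ X ∧ Disjoint Al Ar ∧
  ∃ η : ℝ,
    (((∀ e ∈ Al, u e ≤ η) ∧ (∀ h ∈ Ar, η ≤ u h)) ∨
      ((∀ e ∈ Al, η ≤ u e) ∧ (∀ h ∈ Ar, u h ≤ η))) ∧
    (X.card : ℝ) / 2 ≤ Ar.card ∧
    (Al.card : ℝ) ≤ (X.card : ℝ) / 8 ∧
    (∀ e ∈ Al, (1 / 9 : ℝ) * u e ^ 2 ≤ (u e - η) ^ 2) ∧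
    (1 / 80 : ℝ) * ∑ e ∈ X, u e ^ 2 ≤ ∑ e ∈ Al, u e ^ 2

section Rounds

variable {V E : Type*} [Fintype V] [DecidableEq V] [Fintype E] [DecidableEq E]

/-- The split nodes in `A`, that is `A ∩ X_E`. -/
def splitNodes (A : Finset (V ⊕ E)) : Finset E :=
  Finset.univ.filter fun e => Sum.inr e ∈ A

/-- The matching player: inside `G_E[A]` it returns a cut `S` (possibly empty) of
conductance at most `50 / c` and a matching `σ` of all nodes of `Al \ S` to distinct nodes of
`Ar \ S`. The matched pairs are joined by paths in `G_E[A \ S]`, each carrying one unit of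
flow, and every edge has capacity `c`. -/
def IsMatchingPlayerResponse (G : Multigraph V E) (c : ℝ) (A : Finset (V ⊕ E))
    (Al Ar : Finset E) (S : Finset (V ⊕ E)) (σ : Equiv.Perm E) : Prop :=
  S ⊆ A ∧
  (S = ∅ ∨ G.subdivision.conductanceIn A S ≤ 50 / c) ∧
  (∀ e, σ (σ e) = e) ∧
  (∀ e ∈ Al \ splitNodes S, σ e ∈ Ar \ splitNodes S) ∧
  (∀ e, σ e ≠ e → e ∈ Al \ splitNodes S ∨ σ e ∈ Al \ splitNodes S) ∧
  ∃ P : E → List (E × Bool),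
    (∀ e ∈ Al \ splitNodes S,
      G.subdivision.IsWalk (Sum.inr e) (P e) (Sum.inr (σ e)) ∧
        ∀ i ∈ P e, i ∈ G.subdivision.edgesIn (A \ S)) ∧
    ∀ i : E × Bool, ((∑ e ∈ Al \ splitNodes S, (P e).count i : ℕ) : ℝ) ≤ c

/-- One round of the cut-matching algorithm, from the remaining set `A` and the flow matrix `F`,
with random unit vector `r`, to the remaining set `A'`, the matching `σ` being found. The cut
player uses the projections `u e = ⟨W(x_e), r⟩`. -/
def IsRound (G : Multigraph V E) (c : ℝ) (d : ℕ) (A : Finset (V ⊕ E)) (F : Matrix E E ℝ)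
    (r : Metric.sphere (0 : EuclideanSpace ℝ E) 1)
    (A' : Finset (V ⊕ E)) (σ : Equiv.Perm E) : Prop :=
  ∃ (Al Ar : Finset E) (S : Finset (V ⊕ E)),
    IsCutPlayerChoice (splitNodes A)
      (fun e => ∑ h, walkMatrix d (splitNodes A) F e h * (r : EuclideanSpace ℝ E) h) Al Ar ∧
    IsMatchingPlayerResponse G c A Al Ar S σ ∧
    A' = A \ S

/-- The loop condition `vol(R) ≤ m / (1500 Z)` of the algorithm, where `R` is the complement of `A`
in the subdivision graph. -/
def Continues (G : Multigraph V E) (Z : ℝ) (A : Finset (V ⊕ E)) : Prop :=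
  (G.subdivision.vol Aᶜ : ℝ) ≤ (Fintype.card E : ℝ) / (1500 * Z)

/-- A random execution, for at most `T` rounds, of the cut-matching algorithm on `G` with
parameters `φ`, `Z`, `d`, and capacity `c = 1 / (φ Z)`. `A t` and `ℱ t` are the remaining set and
the information available after `t` rounds, `r t` is the random unit vector drawn in the following
round, independently of the past, and `M t` is the matching found in that round. The two players
may use any rule (adaptive or randomised) that obeys their specification. Nothing is required of
the process once the loop has been left because `R` became too large. -/
structure Execution (G : Multigraph V E) (φ Z : ℝ) (d T : ℕ)
    {Ω : Type*} [mΩ : MeasurableSpace Ω] (μ : Measure Ω) where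
  ℱ : Filtration ℕ mΩ
  r : ℕ → Ω → Metric.sphere (0 : EuclideanSpace ℝ E) 1
  A : ℕ → Ω → Finset (V ⊕ E)
  M : ℕ → Ω → Equiv.Perm E
  measurable_r : ∀ t < T, Measurable[ℱ (t + 1)] (r t)
  law_r : ∀ t < T, μ.map (r t) = sphereUniform E
  indep_r : ∀ t < T, ProbabilityTheory.Indep (MeasurableSpace.comap (r t) inferInstance) (ℱ t) μ
  measurable_A : ∀ t ≤ T, ∀ B, MeasurableSet[ℱ t] {ω | A t ω = B}
  measurable_M : ∀ t < T, ∀ σ, MeasurableSet[ℱ (t + 1)] {ω | M t ω = σ}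
  A_zero : ∀ ω, A 0 ω = Finset.univ
  round : ∀ t < T, ∀ ω, (∀ s ≤ t, Continues G Z (A s ω)) →
    IsRound G (1 / (φ * Z)) d (A t ω) (flowMatrix d (fun s => M s ω) t) (r t ω)
      (A (t + 1) ω) (M t ω)

namespace Execution

variable {G : Multigraph V E} {φ Z : ℝ} {d T : ℕ} {Ω : Type*} [MeasurableSpace Ω] {μ : Measure Ω}

/-- The execution performs `t` rounds: the loop is not left before. -/
def Reaches (X : Execution G φ Z d T μ) (t : ℕ) (ω : Ω) : Prop :=
  ∀ s < t, Continues G Z (X.A s ω)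

/-- The potential `ψ(t)` after `t` rounds. -/
noncomputable def psi (X : Execution G φ Z d T μ) (t : ℕ) (ω : Ω) : ℝ :=
  potential d (splitNodes (X.A t ω)) (flowMatrix d (fun s => X.M s ω) t)

end Execution

end Rounds

end CutMatching

/-! In expectation every round multiplies the potential by at most $1-\Omega(1/\log m)$. Since
$\psi(0)\le m$, after $C\log^2m$ rounds the mean is at most $m^{-\ell-p}$, and Markov's inequality
finishes.

The deterministic half is `potential_drop`. The new remaining set is invariant under the matching,
so its projection $\Delta'$ commutes with $N$, and $\psi(t+1)$ is the trace of $(QBQ)^{2d}$ with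
$Q=\Delta'N$ and $B=\Delta F\Delta$. A Lieb-Thirring inequality bounds this by
$\operatorname{tr}(Q^{4d}B^{2d})=\operatorname{tr}(\Delta'N^{4d}W^2)$. As $N^{4d}=I-\gamma(I-M)$
with $\gamma\ge\frac14$, the potential loses an eighth of the squared distances between matched rows
of $W$ (each pair counted from both ends), and all squared lengths of the deleted rows.

The random half turns this loss into a fraction of $\psi$. A uniform direction sees on average the
fraction $1/m$ of a squared length, and outside a rare bad set at most $O(\log m/m)$ of it for all
rows and row differences at once. On a good direction the cut player's conditions bound the total
squared projection by $O(\log m/m)$ times the loss (`IsRound.potential_le`); the mean of that total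
is $\psi/m$, and the bad set costs at most half of it (`le_integral_gain`). This gives the expected
loss $\Omega(\psi/\log m)$. -/

namespace CutMatching
-- Trace inequalities of Lieb-Thirring type.
section TraceInequalities

variable {E : Type*} [Fintype E]

open Matrix

theorem trace_mul_transpose_nonneg (Z : Matrix E E ℝ) : 0 ≤ (Z * Zᵀ).trace := by
  simp only [trace, diag_apply, mul_apply, transpose_apply]
  exact Finset.sum_nonneg fun i _ => Finset.sum_nonneg fun j _ => mul_self_nonneg _

/-- Expand $\|Z-Z'\|_F^2\ge0$. -/
theorem trace_mul_self_le (Z : Matrix E E ℝ) : (Z * Z).trace ≤ (Z * Zᵀ).trace := by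
  have h := trace_mul_transpose_nonneg (Z - Zᵀ)
  have h1 : (Zᵀ * Zᵀ).trace = (Z * Z).trace := by
    rw [← transpose_mul, trace_transpose]
  have h2 : (Zᵀ * Z).trace = (Z * Zᵀ).trace := trace_mul_comm _ _
  simp only [transpose_sub, transpose_transpose, sub_mul, mul_sub, trace_sub, h1, h2] at h
  linarith

theorem two_mul_trace_mul_le {X Y : Matrix E E ℝ} (hX : Xᵀ = X) (hY : Yᵀ = Y) :
    2 * (X * Y).trace ≤ (X * X).trace + (Y * Y).trace := by
  have h := trace_mul_transpose_nonneg (X - Y)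
  have h1 : (Y * X).trace = (X * Y).trace := trace_mul_comm _ _
  simp only [transpose_sub, hX, hY, sub_mul, mul_sub, trace_sub, h1] at h
  linarith

variable [DecidableEq E]

theorem trace_mul_pow_comm (X Y : Matrix E E ℝ) (n : ℕ) :
    ((X * Y) ^ n).trace = ((Y * X) ^ n).trace := by
  cases n with
  | zero => simp
  | succ n =>
    have h : SemiconjBy Y (X * Y) (Y * X) := by simp [SemiconjBy, mul_assoc]
    rw [pow_succ', mul_assoc, trace_mul_comm, (h.pow_right n).eq, mul_assoc, ← pow_succ]

theorem transpose_pow_eq {X : Matrix E E ℝ} (hX : Xᵀ = X) (n : ℕ) : (X ^ n)ᵀ = X ^ n := by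
  rw [transpose_pow, hX]

/-- The Lieb-Thirring trace inequality for exponents that are powers of two, together with the
comparison of a matrix with its modulus on which it rests. -/
theorem trace_pow_two_pow_le (j : ℕ) :
    (∀ Z : Matrix E E ℝ, (Z ^ 2 ^ (j + 1)).trace ≤ ((Z * Zᵀ) ^ 2 ^ j).trace) ∧
    (∀ C D : Matrix E E ℝ, Cᵀ = C → Dᵀ = D →
      ((C * D) ^ 2 ^ j).trace ≤ (C ^ 2 ^ j * D ^ 2 ^ j).trace) := by
  induction j with
  | zero => exact ⟨fun Z => by simpa [sq] using trace_mul_self_le Z, fun C D _ _ => by simp⟩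
  | succ j ih =>
    -- The two statements feed each other, and neither needs positive semidefinite matrices. For the
    -- modulus, the case $j$ at $Z^2$ gives, up to cyclic order, the product of $ZZ'$ and $Z'Z$; the
    -- second statement separates the factors, and their powers have equal traces.
    obtain ⟨ihS, ihT⟩ := ih
    constructor
    · intro Z
      have e1 : Z ^ 2 ^ (j + 1 + 1) = (Z * Z) ^ 2 ^ (j + 1) := by
        rw [← sq, ← pow_mul, ← pow_succ']
      have e2 : (Z * Z) * (Z * Z)ᵀ = Z * (Z * Zᵀ * Zᵀ) := by
        simp [transpose_mul, mul_assoc]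
      have e3 : (Z * Zᵀ * Zᵀ) * Z = (Z * Zᵀ) * (Zᵀ * Z) := by simp [mul_assoc]
      have hC : (Z * Zᵀ)ᵀ = Z * Zᵀ := by simp
      have hD : (Zᵀ * Z)ᵀ = Zᵀ * Z := by simp
      have h1 := ihS (Z * Z)
      rw [e2, trace_mul_pow_comm Z (Z * Zᵀ * Zᵀ), e3] at h1
      have h2 := ihT _ _ hC hD
      have h3 := two_mul_trace_mul_le (transpose_pow_eq hC (2 ^ j)) (transpose_pow_eq hD (2 ^ j))
      rw [← pow_add, ← pow_add, ← two_mul, ← pow_succ', trace_mul_pow_comm Zᵀ Z] at h3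
      rw [e1]
      linarith
    · intro C D hC hD
      -- Here $(CD)(CD)'=CD^2C$ is cyclically $D^2C^2$, to which the second statement applies with
      -- exponent $2^j$.
      have h1 := ihS (C * D)
      have e2 : (C * D) * (C * D)ᵀ = C * (D * D * C) := by
        simp [transpose_mul, mul_assoc, hC, hD]
      have e3 : D * D * C * C = (D ^ 2) * (C ^ 2) := by simp [sq, mul_assoc]
      rw [e2, trace_mul_pow_comm C (D * D * C), e3] at h1
      have h2 := ihT _ _ (transpose_pow_eq hD 2) (transpose_pow_eq hC 2)
      rw [← pow_mul, ← pow_mul, ← pow_succ', trace_mul_comm] at h2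
      linarith

theorem trace_conj_pow_le {Q B : Matrix E E ℝ} (hQ : Qᵀ = Q) (hB : Bᵀ = B) (j : ℕ) :
    ((Q * B * Q) ^ 2 ^ j).trace ≤ (Q ^ (2 * 2 ^ j) * B ^ 2 ^ j).trace := by
  have h := (trace_pow_two_pow_le j).2 _ _ (transpose_pow_eq hQ 2) hB
  rw [← pow_mul] at h
  rw [mul_assoc, trace_mul_pow_comm, mul_assoc, ← sq, trace_mul_pow_comm]
  exact h

end TraceInequalities
-- The deterministic decrease of the potential in one round.
section PotentialDrop

open Matrix

variable {E : Type*} [DecidableEq E]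

theorem delta_apply_comm (A : Finset E) (i j : E) : Delta A i j = Delta A j i := by
  simp only [Delta, of_apply]
  by_cases h : i = j
  · subst h; rfl
  · simp [h, Ne.symm h, and_comm]

theorem delta_transpose (A : Finset E) : (Delta A)ᵀ = Delta A := by
  ext i j
  exact delta_apply_comm A j i

theorem delta_apply_of_notMem {A : Finset E} {i : E} (hi : i ∉ A) (j : E) : Delta A i j = 0 := by
  simp [Delta, hi]

theorem delta_apply_of_notMem_right {A : Finset E} {j : E} (hj : j ∉ A) (i : E) :
    Delta A i j = 0 := by
  rw [delta_apply_comm, delta_apply_of_notMem hj]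

theorem matchingMatrix_transpose {σ : Equiv.Perm E} (hσ : ∀ e, σ (σ e) = e) :
    (matchingMatrix σ)ᵀ = matchingMatrix σ := by
  ext i j
  have : σ j = i ↔ σ i = j := ⟨fun h => by rw [← h, hσ], fun h => by rw [← h, hσ]⟩
  simp [matchingMatrix, this]

theorem lazyMatrix_transpose (d : ℕ) {σ : Equiv.Perm E} (hσ : ∀ e, σ (σ e) = e) :
    (lazyMatrix d σ)ᵀ = lazyMatrix d σ := by
  simp [lazyMatrix, matchingMatrix_transpose hσ]

variable [Fintype E]

theorem sum_delta_apply (A : Finset E) (i : E) : ∑ h, Delta A i h = 0 := by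
  by_cases hi : i ∈ A
  · have hk : (A.card : ℝ) ≠ 0 := by
      exact_mod_cast (Finset.card_pos.2 ⟨i, hi⟩).ne'
    simp [Delta, hi, Finset.sum_sub_distrib, Finset.sum_ite_mem, hk]
  · simp [delta_apply_of_notMem hi]

/-- `Delta A` is the orthogonal projection onto the vectors supported on `A` with coordinate sum
zero, and these subspaces are nested. The case `A' = A` is idempotence. -/
theorem delta_mul_delta {A' A : Finset E} (h : A' ⊆ A) : Delta A' * Delta A = Delta A' := by
  ext i j
  rw [mul_apply]
  by_cases hj : j ∈ A
  · have key : ∀ x, Delta A' i x * Delta A x j =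
        (if x = j then Delta A' i x else 0) - Delta A' i x * (1 / (A.card : ℝ)) := by
      intro x
      by_cases hx : x ∈ A'
      · have hxA := h hx
        simp only [Delta, of_apply]
        by_cases hxj : x = j
        · simp [hxj, hj]
          ring
        · simp [hxj, hj, hxA]
      · simp [delta_apply_of_notMem_right hx]
    rw [Finset.sum_congr rfl fun x _ => key x, Finset.sum_sub_distrib, ← Finset.sum_mul,
      sum_delta_apply]
    simp
  · simp [delta_apply_of_notMem_right hj, delta_apply_of_notMem_right fun hj' => hj (h hj')]

theorem delta_mul_delta' {A' A : Finset E} (h : A' ⊆ A) : Delta A * Delta A' = Delta A' := by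
  have := congrArg transpose (delta_mul_delta h)
  rwa [transpose_mul, delta_transpose, delta_transpose] at this

theorem matchingMatrix_mul_apply (σ : Equiv.Perm E) (X : Matrix E E ℝ) (i j : E) :
    (matchingMatrix σ * X) i j = X (σ i) j := by
  simp [matchingMatrix, mul_apply]

theorem mul_matchingMatrix_apply {σ : Equiv.Perm E} (hσ : ∀ e, σ (σ e) = e) (X : Matrix E E ℝ)
    (i j : E) : (X * matchingMatrix σ) i j = X i (σ j) := by
  have h : ∀ x, σ x = j ↔ x = σ j := fun x =>
    ⟨fun hx => by rw [← hx, hσ], fun hx => by rw [hx, hσ]⟩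
  simp [matchingMatrix, mul_apply, h]

theorem matchingMatrix_mul_self {σ : Equiv.Perm E} (hσ : ∀ e, σ (σ e) = e) :
    matchingMatrix σ * matchingMatrix σ = 1 := by
  ext i j
  rw [matchingMatrix_mul_apply]
  simp [matchingMatrix, hσ, one_apply]

theorem delta_commute_matchingMatrix {σ : Equiv.Perm E} (hσ : ∀ e, σ (σ e) = e) {A : Finset E}
    (hA : ∀ e, σ e ∈ A ↔ e ∈ A) : Commute (Delta A) (matchingMatrix σ) := by
  ext i j
  rw [mul_matchingMatrix_apply hσ, matchingMatrix_mul_apply]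
  have : i = σ j ↔ σ i = j := ⟨fun h => by rw [h, hσ], fun h => by rw [← h, hσ]⟩
  simp [Delta, hA, this]

theorem delta_commute_lazyMatrix (d : ℕ) {σ : Equiv.Perm E} (hσ : ∀ e, σ (σ e) = e) {A : Finset E}
    (hA : ∀ e, σ e ∈ A ↔ e ∈ A) : Commute (Delta A) (lazyMatrix d σ) :=
  ((Commute.one_right _).smul_right _).add_right
    ((delta_commute_matchingMatrix hσ hA).smul_right _)

/-- With $P=1-M$ one has $P^2=2P$, so $N=1-P/d$ has only the eigenvalues $1$ and $1-2/d$. -/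
theorem lazyMatrix_pow {d : ℕ} (hd : d ≠ 0) {σ : Equiv.Perm E} (hσ : ∀ e, σ (σ e) = e) (n : ℕ) :
    lazyMatrix d σ ^ n =
      1 - ((1 - (1 - 2 / (d : ℝ)) ^ n) / 2) • (1 - matchingMatrix σ) := by
  have hM := matchingMatrix_mul_self hσ
  have hN : lazyMatrix d σ = 1 - (1 / (d : ℝ)) • (1 - matchingMatrix σ) := by
    have : ((d : ℝ) - 1) / d = 1 - 1 / d := by
      have : (d : ℝ) ≠ 0 := by exact_mod_cast hd
      field_simp
    rw [lazyMatrix, this]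
    module
  have hP : (1 - matchingMatrix σ) * (1 - matchingMatrix σ) =
      (2 : ℝ) • (1 - matchingMatrix σ) := by
    simp only [mul_sub, sub_mul, hM, one_mul, mul_one]
    module
  induction n with
  | zero => simp
  | succ n ih =>
    rw [pow_succ, ih, hN]
    generalize 1 - matchingMatrix σ = P at hP
    simp only [mul_sub, sub_mul, smul_mul_assoc, mul_smul_comm, hP, one_mul, mul_one, smul_smul]
    rw [pow_succ]
    module

/-- The exponent $4d$ makes the power at most $e^{-8}\le\frac12$; $d\ge2$ keeps its base
nonnegative. -/
theorem quarter_le_rate {d : ℕ} (hd : 2 ≤ d) :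
    1 / 4 ≤ (1 - (1 - 2 / (d : ℝ)) ^ (4 * d)) / 2 := by
  have hd' : (2 : ℝ) ≤ d := by exact_mod_cast hd
  have h0 : 0 ≤ 1 - 2 / (d : ℝ) := by
    rw [sub_nonneg, div_le_one (by linarith)]; exact hd'
  have h1 : 1 - 2 / (d : ℝ) ≤ Real.exp (-(2 / (d : ℝ))) := by
    have := Real.add_one_le_exp (-(2 / (d : ℝ)))
    linarith
  have h2 : (1 - 2 / (d : ℝ)) ^ (4 * d) ≤ Real.exp (-8) := by
    refine (pow_le_pow_left₀ h0 h1 _).trans_eq ?_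
    rw [← Real.exp_nat_mul]
    congr 1
    push_cast
    field_simp
    norm_num
  have h3 : Real.exp (-8) ≤ 1 / 2 := by
    rw [Real.exp_neg, one_div]
    refine inv_anti₀ (by norm_num) ?_
    have := Real.add_one_le_exp (8 : ℝ)
    linarith
  linarith

theorem trace_sq_of_transpose {W : Matrix E E ℝ} (hW : Wᵀ = W) :
    (W ^ 2).trace = ∑ e, ∑ h, W e h ^ 2 := by
  simp only [sq, trace, diag_apply, mul_apply]
  refine Finset.sum_congr rfl fun i _ => Finset.sum_congr rfl fun j _ => ?_
  rw [← congrFun (congrFun hW i) j, transpose_apply]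

theorem walkMatrix_transpose (d : ℕ) (A : Finset E) {F : Matrix E E ℝ} (hF : Fᵀ = F) :
    (walkMatrix d A F)ᵀ = walkMatrix d A F := by
  rw [walkMatrix]
  apply transpose_pow_eq
  simp [transpose_mul, delta_transpose, hF, mul_assoc]

theorem potential_eq_sum (d : ℕ) (A : Finset E) {F : Matrix E E ℝ} (hF : Fᵀ = F) :
    potential d A F = ∑ e, ∑ h, walkMatrix d A F e h ^ 2 :=
  trace_sq_of_transpose (walkMatrix_transpose d A hF)

theorem walkMatrix_apply_of_notMem {d : ℕ} (hd : d ≠ 0) {A : Finset E} {F : Matrix E E ℝ} {e : E}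
    (he : e ∉ A) (h : E) : walkMatrix d A F e h = 0 := by
  obtain ⟨n, rfl⟩ := Nat.exists_eq_succ_of_ne_zero hd
  rw [walkMatrix, Nat.succ_eq_add_one, pow_succ', mul_assoc, mul_assoc, mul_apply]
  simp [delta_apply_of_notMem he]

/-- The rank-one part of `Delta A` only subtracts a nonnegative multiple of the squared column sums
of `W` over `A`. -/
theorem trace_delta_mul_sq_le (A : Finset E) {W : Matrix E E ℝ} (hW : Wᵀ = W) :
    (Delta A * W ^ 2).trace ≤ ∑ e ∈ A, ∑ h, W e h ^ 2 := by
  have hW' : ∀ i j, W i j = W j i := fun i j => congrFun (congrFun hW j) i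
  have key : (Delta A * W ^ 2).trace =
      (∑ e ∈ A, ∑ h, W e h ^ 2) - 1 / (A.card : ℝ) * ∑ h, (∑ e ∈ A, W e h) ^ 2 := by
    have h1 : ∀ i j, (W ^ 2) i j = ∑ h, W i h * W j h := by
      intro i j
      rw [sq, mul_apply]
      exact Finset.sum_congr rfl fun h _ => by rw [hW' j h]
    have h2 : ∑ h, (∑ e ∈ A, W e h) ^ 2 = ∑ i ∈ A, ∑ j ∈ A, ∑ h, W j h * W i h := by
      simp only [sq, Finset.sum_mul_sum]
      rw [Finset.sum_comm]
      refine Finset.sum_congr rfl fun i _ => ?_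
      rw [Finset.sum_comm]
      exact Finset.sum_congr rfl fun j _ => Finset.sum_congr rfl fun h _ => mul_comm _ _
    rw [h2]
    simp only [trace, diag_apply, mul_apply, h1]
    rw [← Finset.sum_subset A.subset_univ
      (fun i _ hi => by simp [delta_apply_of_notMem hi]), Finset.mul_sum, ← Finset.sum_sub_distrib]
    refine Finset.sum_congr rfl fun i hi => ?_
    simp only [Delta, of_apply, hi, sub_mul, Finset.sum_sub_distrib, true_and, and_true, ite_mul,
      zero_mul, one_mul, Finset.sum_ite_eq, Finset.mem_univ, if_true, Finset.sum_ite_mem,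
      Finset.univ_inter, ← Finset.mul_sum, sq]
  rw [key]
  have : 0 ≤ 1 / (A.card : ℝ) * ∑ h, (∑ e ∈ A, W e h) ^ 2 := by positivity
  linarith

/-- Since `A` is $\sigma$-invariant, the rank-one part of `Delta A` is annihilated by $1-M$. What
remains is the Laplacian form of the matching; the factor $\frac12$ appears because the sum meets
each pair twice. -/
theorem trace_delta_mul_laplacian {σ : Equiv.Perm E} (hσ : ∀ e, σ (σ e) = e) {A : Finset E}
    (hA : ∀ e, σ e ∈ A ↔ e ∈ A) {W : Matrix E E ℝ} (hW : Wᵀ = W) :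
    (Delta A * (1 - matchingMatrix σ) * W ^ 2).trace =
      1 / 2 * ∑ e ∈ A, ∑ h, (W e h - W (σ e) h) ^ 2 := by
  have hW' : ∀ i j, W i j = W j i := fun i j => congrFun (congrFun hW j) i
  have h1 : ∀ i j, (W ^ 2) i j = ∑ h, W i h * W j h := by
    intro i j
    rw [sq, mul_apply]
    exact Finset.sum_congr rfl fun h _ => by rw [hW' j h]
  have h2 : ∀ i j, (Delta A * (1 - matchingMatrix σ)) i j =
      if i ∈ A then (if i = j then 1 else 0) - (if σ i = j then 1 else 0) else 0 := by
    intro i j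
    rw [mul_sub, mul_one, Matrix.sub_apply, mul_matchingMatrix_apply hσ]
    have : i = σ j ↔ σ i = j := ⟨fun h => by rw [h, hσ], fun h => by rw [← h, hσ]⟩
    by_cases hi : i ∈ A
    · simp [Delta, hi, hA, this]
    · simp [Delta, hi]
  have h3 : (Delta A * (1 - matchingMatrix σ) * W ^ 2).trace =
      ∑ e ∈ A, ∑ h, (W e h * W e h - W (σ e) h * W e h) := by
    simp only [trace, diag_apply, mul_apply (M := Delta A * _), h2]
    rw [← Finset.sum_subset A.subset_univ (fun i _ hi => by simp [hi])]
    refine Finset.sum_congr rfl fun i hi => ?_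
    simp [hi, sub_mul, h1]
  have h4 : ∑ e ∈ A, ∑ h, W (σ e) h * W (σ e) h = ∑ e ∈ A, ∑ h, W e h * W e h :=
    Finset.sum_equiv σ (fun e => (hA e).symm) (fun e _ => rfl)
  have h5 : ∑ e ∈ A, ∑ h, (W e h - W (σ e) h) ^ 2 =
      ∑ e ∈ A, ∑ h, W e h * W e h + ∑ e ∈ A, ∑ h, W (σ e) h * W (σ e) h
        - 2 * ∑ e ∈ A, ∑ h, W (σ e) h * W e h := by
    simp only [Finset.mul_sum, ← Finset.sum_add_distrib, ← Finset.sum_sub_distrib]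
    exact Finset.sum_congr rfl fun e _ => Finset.sum_congr rfl fun h _ => by ring
  rw [h3, h5, h4]
  simp only [Finset.sum_sub_distrib]
  ring

/-- The decrease of the potential in one round, in which the remaining set shrinks from `A` to `A'`
and the matching `σ` is found on `A'`. -/
theorem potential_drop {k : ℕ} (hk : 1 ≤ k) {A' A : Finset E} (hAA : A' ⊆ A)
    {σ : Equiv.Perm E} (hσ : ∀ e, σ (σ e) = e) (hA : ∀ e, σ e ∈ A' ↔ e ∈ A')
    {F : Matrix E E ℝ} (hF : Fᵀ = F) :
    potential (2 ^ k) A' (lazyMatrix (2 ^ k) σ * F * lazyMatrix (2 ^ k) σ) +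
      1 / 8 * ∑ e ∈ A', ∑ h, (walkMatrix (2 ^ k) A F e h - walkMatrix (2 ^ k) A F (σ e) h) ^ 2 +
      ∑ e ∈ A'ᶜ, ∑ h, walkMatrix (2 ^ k) A F e h ^ 2 ≤ potential (2 ^ k) A F := by
  have hd : 2 ≤ 2 ^ k := by
    calc 2 = 2 ^ 1 := rfl
      _ ≤ 2 ^ k := Nat.pow_le_pow_right (by norm_num) hk
  have hd0 : 2 ^ k ≠ 0 := by positivity
  set N := lazyMatrix (2 ^ k) σ with hN
  set B := Delta A * F * Delta A with hB
  set W := walkMatrix (2 ^ k) A F with hW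
  have hWW : W = B ^ 2 ^ k := rfl
  have hBt : Bᵀ = B := by simp [hB, transpose_mul, delta_transpose, hF, mul_assoc]
  have hWt : Wᵀ = W := walkMatrix_transpose _ _ hF
  have hc : Commute (Delta A') N := delta_commute_lazyMatrix _ hσ hA
  have hQt : (Delta A' * N)ᵀ = Delta A' * N := by
    rw [transpose_mul, delta_transpose, lazyMatrix_transpose _ hσ, hc.eq]
  -- The old projection may be inserted next to the new one, so that the new matrix is a conjugate
  -- of the old one by `Delta A' * N`.
  have e1 : Delta A' * (N * F * N) * Delta A' = (Delta A' * N) * B * (Delta A' * N) := by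
    have a1 : Delta A' * N * Delta A = Delta A' * N := by
      rw [hc.eq, mul_assoc, delta_mul_delta hAA]
    have a2 : Delta A * (Delta A' * N) = Delta A' * N := by
      rw [← mul_assoc, delta_mul_delta' hAA]
    calc Delta A' * (N * F * N) * Delta A' = (Delta A' * N) * F * (N * Delta A') := by
          simp only [mul_assoc]
      _ = (Delta A' * N * Delta A) * F * (Delta A * (Delta A' * N)) := by rw [a1, a2, hc.eq]
      _ = _ := by simp only [hB, mul_assoc]
  have e2 : potential (2 ^ k) A' (N * F * N) =
      ((Delta A' * N * B * (Delta A' * N)) ^ 2 ^ (k + 1)).trace := by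
    rw [potential, walkMatrix, e1, ← pow_mul, ← pow_succ]
  have e3 := trace_conj_pow_le hQt hBt (k + 1)
  have e4 : (Delta A' * N) ^ (2 * 2 ^ (k + 1)) = Delta A' * N ^ (4 * 2 ^ k) := by
    have hid : IsIdempotentElem (Delta A') := delta_mul_delta subset_rfl
    have : 2 * 2 ^ (k + 1) = 4 * 2 ^ k := by ring
    rw [this, hc.mul_pow, hid.pow_eq (by positivity)]
  have e5 : B ^ 2 ^ (k + 1) = W ^ 2 := by rw [hWW, ← pow_mul, ← pow_succ]
  rw [← e2, e4, e5, lazyMatrix_pow hd0 hσ] at e3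
  set γ : ℝ := (1 - (1 - 2 / ((2 ^ k : ℕ) : ℝ)) ^ (4 * 2 ^ k)) / 2 with hγ
  have hγ4 : 1 / 4 ≤ γ := quarter_le_rate hd
  rw [mul_sub, mul_one, sub_mul, trace_sub, mul_smul_comm, smul_mul_assoc, trace_smul,
    trace_delta_mul_laplacian hσ hA hWt, smul_eq_mul] at e3
  have e6 := trace_delta_mul_sq_le A' hWt
  have e7 : potential (2 ^ k) A F =
      ∑ e ∈ A', ∑ h, W e h ^ 2 + ∑ e ∈ A'ᶜ, ∑ h, W e h ^ 2 := by
    rw [Finset.sum_add_sum_compl]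
    exact potential_eq_sum _ _ hF
  have e8 : 0 ≤ ∑ e ∈ A', ∑ h, (W e h - W (σ e) h) ^ 2 := by positivity
  rw [e7]
  -- The coefficient $\frac18$ is $\gamma\cdot\frac12$ with $\gamma\ge\frac14$.
  nlinarith

theorem potential_one_le {d : ℕ} (hd : d ≠ 0) (A : Finset E) :
    potential d A 1 ≤ Fintype.card E := by
  have hid : IsIdempotentElem (Delta A) := delta_mul_delta subset_rfl
  rw [potential, walkMatrix, mul_one, hid.eq, hid.pow_eq hd, hid.pow_eq two_ne_zero]
  have h : ∀ i, Delta A i i ≤ 1 := by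
    intro i
    have : 0 ≤ 1 / (A.card : ℝ) := by positivity
    simp only [Delta, of_apply]
    split_ifs <;> linarith
  calc (Delta A).trace ≤ ∑ _i : E, (1 : ℝ) := Finset.sum_le_sum fun i _ => h i
    _ = Fintype.card E := by simp

end PotentialDrop
-- Second moments and caps of the uniform distribution on the sphere.
section UniformSphere

open MeasureTheory Metric
open scoped Pointwise RealInnerProductSpace

variable {E : Type*} [Fintype E]

instance isProbabilityMeasure_sphereUniform [Nonempty E] :
    IsProbabilityMeasure (sphereUniform E) := by
  classical
  refine ⟨?_⟩
  have h0 : (volume : Measure (EuclideanSpace ℝ E)).toSphere Set.univ ≠ 0 :=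
    Measure.measure_univ_ne_zero.2 (Measure.toSphere_ne_zero _)
  simp only [sphereUniform, Measure.smul_apply, smul_eq_mul]
  exact ENNReal.inv_mul_cancel h0 (measure_ne_top _ _)

/-- A linear isometry equivalence acting on the unit sphere. -/
noncomputable def sphereMap (f : EuclideanSpace ℝ E ≃ₗᵢ[ℝ] EuclideanSpace ℝ E)
    (x : sphere (0 : EuclideanSpace ℝ E) 1) : sphere (0 : EuclideanSpace ℝ E) 1 :=
  ⟨f x, by simp⟩

/-- The sphere measure of a set is proportional to the volume of the cone over it, and linear
isometries preserve volume and carry cones to cones. -/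
theorem measurePreserving_sphereMap (f : EuclideanSpace ℝ E ≃ₗᵢ[ℝ] EuclideanSpace ℝ E) :
    MeasurePreserving (sphereMap f) (sphereUniform E) (sphereUniform E) := by
  have hm : Measurable (sphereMap f) :=
    ((f.continuous.comp continuous_subtype_val).subtype_mk _).measurable
  refine MeasurePreserving.smul_measure (c := _) ⟨hm, ?_⟩
  ext s hs
  rw [Measure.map_apply hm hs, Measure.toSphere_apply' _ (hm hs), Measure.toSphere_apply' _ hs]
  congr 1
  rw [← f.measurePreserving.measure_preimage_emb f.toHomeomorph.measurableEmbedding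
    (Set.Ioo (0 : ℝ) 1 • (((↑) : sphere (0 : EuclideanSpace ℝ E) 1 → EuclideanSpace ℝ E) '' s))]
  congr 1
  ext x
  simp only [Set.mem_smul, Set.mem_image, Set.mem_preimage]
  constructor
  · rintro ⟨a, ha, _, ⟨y, hy, rfl⟩, rfl⟩
    exact ⟨a, ha, _, ⟨_, hy, rfl⟩, by simp [sphereMap]⟩
  · rintro ⟨a, ha, _, ⟨y, hy, rfl⟩, h⟩
    refine ⟨a, ha, _, ⟨sphereMap f.symm y, ?_, rfl⟩, ?_⟩
    · have : sphereMap f (sphereMap f.symm y) = y := Subtype.ext (by simp [sphereMap])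
      rwa [this]
    · apply f.injective
      rw [← h]
      simp [sphereMap]

theorem integral_inner_sq_eq_of_norm_eq {v w : EuclideanSpace ℝ E} (h : ‖v‖ = ‖w‖) :
    ∫ x, ⟪v, (x : EuclideanSpace ℝ E)⟫ ^ 2 ∂sphereUniform E =
      ∫ x, ⟪w, (x : EuclideanSpace ℝ E)⟫ ^ 2 ∂sphereUniform E := by
  let f := (ℝ ∙ (v - w))ᗮ.reflection
  have hf : f v = w := Submodule.reflection_sub h
  have hmp := measurePreserving_sphereMap f
  have hc : Continuous fun x : sphere (0 : EuclideanSpace ℝ E) 1 =>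
      ⟪w, (x : EuclideanSpace ℝ E)⟫ ^ 2 :=
    (continuous_const.inner continuous_subtype_val).pow 2
  calc ∫ x, ⟪v, (x : EuclideanSpace ℝ E)⟫ ^ 2 ∂sphereUniform E
      = ∫ x, ⟪w, (sphereMap f x : EuclideanSpace ℝ E)⟫ ^ 2 ∂sphereUniform E := by
        refine integral_congr_ae (Filter.Eventually.of_forall fun x => ?_)
        show ⟪v, (x : EuclideanSpace ℝ E)⟫ ^ 2 = ⟪w, f x⟫ ^ 2
        rw [← hf, f.inner_map_map]
    _ = ∫ x, ⟪w, (x : EuclideanSpace ℝ E)⟫ ^ 2 ∂((sphereUniform E).map (sphereMap f)) :=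
        (integral_map hmp.measurable.aemeasurable hc.aestronglyMeasurable).symm
    _ = _ := by rw [hmp.map_eq]

theorem integrable_of_continuous_sphere [Nonempty E]
    {g : sphere (0 : EuclideanSpace ℝ E) 1 → ℝ} (hg : Continuous g) :
    Integrable g (sphereUniform E) :=
  hg.integrable_of_hasCompactSupport (HasCompactSupport.of_compactSpace g)

/-- By rotation invariance `v` may be replaced by `‖v‖` times any coordinate vector; summing over
all coordinates gives `‖v‖ ^ 2`, because the squared coordinates of a unit vector add up to $1$. -/
theorem integral_inner_sq [Nonempty E] (v : EuclideanSpace ℝ E) :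
    ∫ x, ⟪v, (x : EuclideanSpace ℝ E)⟫ ^ 2 ∂sphereUniform E = ‖v‖ ^ 2 / Fintype.card E := by
  classical
  have h1 : ∀ i : E, ∫ x, ⟪v, (x : EuclideanSpace ℝ E)⟫ ^ 2 ∂sphereUniform E =
      ∫ x, ‖v‖ ^ 2 * (x : EuclideanSpace ℝ E) i ^ 2 ∂sphereUniform E := by
    intro i
    rw [integral_inner_sq_eq_of_norm_eq (w := ‖v‖ • EuclideanSpace.single i (1 : ℝ))
      (by simp [norm_smul])]
    simp [inner_smul_left, mul_pow, EuclideanSpace.inner_single_left]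
  have h2 : (Fintype.card E : ℝ) * ∫ x, ⟪v, (x : EuclideanSpace ℝ E)⟫ ^ 2 ∂sphereUniform E =
      ‖v‖ ^ 2 := by
    calc _ = ∑ i : E, ∫ x, ⟪v, (x : EuclideanSpace ℝ E)⟫ ^ 2 ∂sphereUniform E := by
          simp
      _ = ∑ i : E, ∫ x, ‖v‖ ^ 2 * (x : EuclideanSpace ℝ E) i ^ 2 ∂sphereUniform E :=
          Finset.sum_congr rfl fun i _ => h1 i
      _ = ∫ x, ∑ i : E, ‖v‖ ^ 2 * (x : EuclideanSpace ℝ E) i ^ 2 ∂sphereUniform E := by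
          rw [integral_finsetSum]
          intro i _
          exact integrable_of_continuous_sphere (by fun_prop)
      _ = ∫ _x, ‖v‖ ^ 2 ∂sphereUniform E := by
          refine integral_congr_ae (Filter.Eventually.of_forall fun x => ?_)
          have hx : ∑ i, (x : EuclideanSpace ℝ E) i ^ 2 = 1 := by
            rw [← EuclideanSpace.real_norm_sq_eq, norm_eq_of_mem_sphere]
            norm_num
          simp only [← Finset.mul_sum, hx, mul_one]
      _ = ‖v‖ ^ 2 := by simp
  have hm : (Fintype.card E : ℝ) ≠ 0 := by exact_mod_cast Fintype.card_ne_zero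
  field_simp
  linarith

/-- The measure of a spherical cap: the cone over it lies in a ball of radius `√(1 - ε²)`. -/
theorem sphereUniform_cap_le [Nonempty E] {v : EuclideanSpace ℝ E} (hv : ‖v‖ = 1) {ε : ℝ}
    (hε : 0 ≤ ε) (hε2 : ε ^ 2 ≤ 1 / 2) :
    sphereUniform E {x | ε ≤ ⟪v, (x : EuclideanSpace ℝ E)⟫} ≤
      ENNReal.ofReal (Real.sqrt (1 - ε ^ 2) ^ Fintype.card E) := by
  classical
  have hms : MeasurableSet {x : sphere (0 : EuclideanSpace ℝ E) 1 | ε ≤ ⟪v, (x : EuclideanSpace ℝ E)⟫} :=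
    (isClosed_le continuous_const (continuous_const.inner continuous_subtype_val)).measurableSet
  have hsub : Set.Ioo (0 : ℝ) 1 • (((↑) : sphere (0 : EuclideanSpace ℝ E) 1 → (EuclideanSpace ℝ E)) '' {x | ε ≤ ⟪v, (x : EuclideanSpace ℝ E)⟫}) ⊆
      closedBall (ε • v) (Real.sqrt (1 - ε ^ 2)) := by
    rintro _ ⟨a, ⟨ha0, ha1⟩, _, ⟨y, hy, rfl⟩, rfl⟩
    have hy1 : ‖(y : EuclideanSpace ℝ E)‖ = 1 := norm_eq_of_mem_sphere y
    have hy' : ε ≤ ⟪v, (y : EuclideanSpace ℝ E)⟫ := hy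
    rw [mem_closedBall, dist_eq_norm]
    apply Real.le_sqrt_of_sq_le
    have e : ‖a • (y : EuclideanSpace ℝ E) - ε • v‖ ^ 2 = a ^ 2 - 2 * (a * ε * ⟪v, (y : EuclideanSpace ℝ E)⟫) + ε ^ 2 := by
      rw [norm_sub_sq_real, norm_smul, norm_smul, hy1, hv, inner_smul_left, inner_smul_right,
        real_inner_comm]
      simp
      ring
    show ‖a • (y : EuclideanSpace ℝ E) - ε • v‖ ^ 2 ≤ _
    rw [e]
    have h1 : a * ε * ε ≤ a * ε * ⟪v, (y : EuclideanSpace ℝ E)⟫ := by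
      apply mul_le_mul_of_nonneg_left hy'
      positivity
    -- It remains that $a^2-2a\varepsilon^2+\varepsilon^2\le1-\varepsilon^2$. The left side is
    -- convex in $a$, so the ends decide: $a=1$ gives equality and $a=0$ is the assumption
    -- $\varepsilon^2\le\frac12$.
    nlinarith
  have hvol : (volume : Measure (EuclideanSpace ℝ E)) (closedBall (ε • v) (Real.sqrt (1 - ε ^ 2))) =
      ENNReal.ofReal (Real.sqrt (1 - ε ^ 2) ^ Fintype.card E) * volume (ball (0 : EuclideanSpace ℝ E) 1) := by
    rw [Measure.addHaar_closedBall _ _ (Real.sqrt_nonneg _), finrank_euclideanSpace]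
  simp only [sphereUniform, Measure.smul_apply, smul_eq_mul]
  rw [mul_comm, ← div_eq_mul_inv]
  refine ENNReal.div_le_of_le_mul ?_
  rw [Measure.toSphere_apply' _ hms, Measure.toSphere_apply_univ, mul_left_comm, ← hvol]
  gcongr

theorem sqrt_one_sub_pow_le {ε : ℝ} (n : ℕ) :
    Real.sqrt (1 - ε ^ 2) ^ n ≤ Real.exp (-(n * ε ^ 2 / 2)) := by
  have h : Real.sqrt (1 - ε ^ 2) ≤ Real.exp (-(ε ^ 2 / 2)) := by
    apply Real.sqrt_le_iff.2
    refine ⟨(Real.exp_pos _).le, ?_⟩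
    rw [← Real.exp_nat_mul]
    have := Real.add_one_le_exp (-(ε ^ 2))
    have e : ((2 : ℕ) : ℝ) * -(ε ^ 2 / 2) = -(ε ^ 2) := by push_cast; ring
    rw [e]
    linarith
  refine (pow_le_pow_left₀ (Real.sqrt_nonneg _) h n).trans_eq ?_
  rw [← Real.exp_nat_mul]
  congr 1
  ring

/-- The event lies in two opposite caps. For `1 < L` it is empty by Cauchy-Schwarz; otherwise the
cap height $\sqrt{L/2}$ satisfies the restriction of the cap bound. -/
theorem sphereUniform_inner_sq_gt_le [Nonempty E] (v : EuclideanSpace ℝ E) {L : ℝ} (hL : 0 ≤ L) :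
    (sphereUniform E).real {x | L * ‖v‖ ^ 2 < ⟪v, (x : EuclideanSpace ℝ E)⟫ ^ 2} ≤
      2 * Real.exp (-(Fintype.card E * L / 4)) := by
  have hcs : ∀ x : sphere (0 : EuclideanSpace ℝ E) 1,
      ⟪v, (x : EuclideanSpace ℝ E)⟫ ^ 2 ≤ ‖v‖ ^ 2 := by
    intro x
    have h := abs_real_inner_le_norm v (x : EuclideanSpace ℝ E)
    rw [norm_eq_of_mem_sphere, mul_one] at h
    exact sq_le_sq.2 (by rwa [abs_norm])
  by_cases htriv : v = 0 ∨ 1 < L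
  · have : {x : sphere (0 : EuclideanSpace ℝ E) 1 |
        L * ‖v‖ ^ 2 < ⟪v, (x : EuclideanSpace ℝ E)⟫ ^ 2} = ∅ := by
      ext x
      simp only [Set.mem_ofPred_eq, Set.mem_empty_iff_false, iff_false, not_lt]
      rcases htriv with rfl | h
      · simp
      · nlinarith [hcs x, sq_nonneg ‖v‖]
    rw [this]
    simp only [measureReal_empty]
    positivity
  push Not at htriv
  obtain ⟨hv, hL1⟩ := htriv
  have hn : 0 < ‖v‖ := norm_pos_iff.2 hv
  set ε := Real.sqrt (L / 2) with hε
  have hε2 : ε ^ 2 = L / 2 := Real.sq_sqrt (by positivity)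
  have hε0 : 0 ≤ ε := Real.sqrt_nonneg _
  have hcap : ∀ u : EuclideanSpace ℝ E, ‖u‖ = 1 →
      (sphereUniform E).real {x | ε ≤ ⟪u, (x : EuclideanSpace ℝ E)⟫} ≤
        Real.exp (-(Fintype.card E * L / 4)) := by
    intro u hu
    have h := sphereUniform_cap_le hu hε0 (by rw [hε2]; linarith)
    have h' := ENNReal.toReal_mono ENNReal.ofReal_ne_top h
    rw [ENNReal.toReal_ofReal (by positivity)] at h'
    refine h'.trans ((sqrt_one_sub_pow_le _).trans_eq ?_)
    rw [hε2]
    congr 1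
    ring
  set u := ‖v‖⁻¹ • v with hu
  have hu1 : ‖u‖ = 1 := by
    rw [hu, norm_smul, norm_inv, norm_norm, inv_mul_cancel₀ hn.ne']
  have hvu : v = ‖v‖ • u := by rw [hu, smul_smul, mul_inv_cancel₀ hn.ne', one_smul]
  have hsub : {x : sphere (0 : EuclideanSpace ℝ E) 1 |
      L * ‖v‖ ^ 2 < ⟪v, (x : EuclideanSpace ℝ E)⟫ ^ 2} ⊆
      {x | ε ≤ ⟪u, (x : EuclideanSpace ℝ E)⟫} ∪ {x | ε ≤ ⟪-u, (x : EuclideanSpace ℝ E)⟫} := by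
    intro x hx
    simp only [Set.mem_ofPred_eq] at hx
    have e : ⟪v, (x : EuclideanSpace ℝ E)⟫ = ‖v‖ * ⟪u, (x : EuclideanSpace ℝ E)⟫ := by
      conv_lhs => rw [hvu]
      rw [inner_smul_left]
      simp
    rw [e, mul_pow, mul_comm] at hx
    have h1 : L < ⟪u, (x : EuclideanSpace ℝ E)⟫ ^ 2 := lt_of_mul_lt_mul_left hx (sq_nonneg _)
    have h2 : ε ^ 2 ≤ ⟪u, (x : EuclideanSpace ℝ E)⟫ ^ 2 := by rw [hε2]; linarith
    have h3 := sq_le_sq.1 h2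
    rw [abs_of_nonneg hε0] at h3
    rcases le_abs.1 h3 with h | h
    · exact Or.inl h
    · right
      simpa [inner_neg_left] using h
  calc _ ≤ (sphereUniform E).real ({x | ε ≤ ⟪u, (x : EuclideanSpace ℝ E)⟫} ∪
        {x | ε ≤ ⟪-u, (x : EuclideanSpace ℝ E)⟫}) := measureReal_mono hsub
    _ ≤ _ := measureReal_union_le _ _
    _ ≤ _ := by
      rw [two_mul]
      exact add_le_add (hcap u hu1) (hcap (-u) (by rw [norm_neg, hu1]))

end UniformSphere
-- Projections of the rows onto a random direction.
section Projections

open MeasureTheory Metric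
open scoped RealInnerProductSpace

variable {E : Type*} [Fintype E]

/-- The inner product of the vector `w` with the random direction `x`. -/
noncomputable def proj (w : E → ℝ) (x : sphere (0 : EuclideanSpace ℝ E) 1) : ℝ :=
  ∑ h, w h * (x : EuclideanSpace ℝ E) h

theorem proj_eq_inner (w : E → ℝ) (x : sphere (0 : EuclideanSpace ℝ E) 1) :
    proj w x = ⟪WithLp.toLp 2 w, (x : EuclideanSpace ℝ E)⟫ := by
  simp [proj, PiLp.inner_apply, mul_comm]

theorem norm_toLp_sq (w : E → ℝ) : ‖(WithLp.toLp 2 w : EuclideanSpace ℝ E)‖ ^ 2 = ∑ h, w h ^ 2 := by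
  rw [EuclideanSpace.real_norm_sq_eq]

theorem continuous_proj (w : E → ℝ) : Continuous (proj w) := by
  unfold proj
  fun_prop

theorem proj_sub (v w : E → ℝ) (x : sphere (0 : EuclideanSpace ℝ E) 1) :
    proj (v - w) x = proj v x - proj w x := by
  simp [proj, sub_mul]

theorem proj_sq_le (w : E → ℝ) (x : sphere (0 : EuclideanSpace ℝ E) 1) :
    proj w x ^ 2 ≤ ∑ h, w h ^ 2 := by
  have hx : ∑ i, (x : EuclideanSpace ℝ E) i ^ 2 = 1 := by
    rw [← EuclideanSpace.real_norm_sq_eq, norm_eq_of_mem_sphere]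
    norm_num
  have := Finset.sum_mul_sq_le_sq_mul_sq Finset.univ w fun h => (x : EuclideanSpace ℝ E) h
  rwa [hx, mul_one] at this

theorem integral_proj_sq [Nonempty E] (w : E → ℝ) :
    ∫ x, proj w x ^ 2 ∂sphereUniform E = (∑ h, w h ^ 2) / Fintype.card E := by
  simp only [proj_eq_inner, integral_inner_sq, norm_toLp_sq]

/-- The directions in which the projection of `w` is exceptionally long. -/
def longSet (L : ℝ) (w : E → ℝ) : Set (sphere (0 : EuclideanSpace ℝ E) 1) :=
  {x | L * ∑ h, w h ^ 2 < proj w x ^ 2}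

theorem measurableSet_longSet (L : ℝ) (w : E → ℝ) : MeasurableSet (longSet L w) :=
  (isOpen_lt continuous_const ((continuous_proj w).pow 2)).measurableSet

theorem measure_longSet_le [Nonempty E] (w : E → ℝ) {L : ℝ} (hL : 0 ≤ L) :
    (sphereUniform E).real (longSet L w) ≤ 2 * Real.exp (-(Fintype.card E * L / 4)) := by
  have := sphereUniform_inner_sq_gt_le (WithLp.toLp 2 w) hL
  simpa only [longSet, proj_eq_inner, norm_toLp_sq] using this

/-- The directions in which the projection of some row of `W`, or of the difference of two rows,
is exceptionally long. -/
def badSet (L : ℝ) (W : Matrix E E ℝ) : Set (sphere (0 : EuclideanSpace ℝ E) 1) :=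
  (⋃ e, longSet L (W e)) ∪ ⋃ i : E × E, longSet L (W i.1 - W i.2)

theorem measurableSet_badSet (L : ℝ) (W : Matrix E E ℝ) : MeasurableSet (badSet L W) :=
  (MeasurableSet.iUnion fun _ => measurableSet_longSet _ _).union
    (MeasurableSet.iUnion fun _ => measurableSet_longSet _ _)

/-- The length bound which all projections obey with high probability. -/
noncomputable def projBound (E : Type*) [Fintype E] : ℝ :=
  24 * Real.log (Fintype.card E) / Fintype.card E

/-- A union bound over $m$ rows and $m^2$ pairs. The constant $24$ in `projBound` makes each event
have probability at most $2m^{-6}$. -/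
theorem measure_badSet_le (hE : 2 ≤ Fintype.card E) (W : Matrix E E ℝ) :
    (sphereUniform E).real (badSet (projBound E) W) ≤ 1 / (2 * Fintype.card E) := by
  have hne : Nonempty E := Fintype.card_pos_iff.1 (by omega)
  set m : ℝ := (Fintype.card E : ℝ) with hm
  have hm2 : (2 : ℝ) ≤ m := by rw [hm]; exact_mod_cast hE
  have hL : 0 ≤ projBound E := by
    have := Real.log_nonneg (by linarith : (1 : ℝ) ≤ m)
    unfold projBound
    positivity
  set q : ℝ := 2 * Real.exp (-(Fintype.card E * projBound E / 4)) with hq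
  have hqm : q = 2 / m ^ 6 := by
    have e : -((Fintype.card E : ℝ) * projBound E / 4) = -((6 : ℕ) * Real.log m) := by
      unfold projBound
      rw [← hm]
      field_simp
      ring
    rw [hq, e, Real.exp_neg, Real.exp_nat_mul, Real.exp_log (by linarith), div_eq_mul_inv]
  have h1 : (sphereUniform E).real (⋃ e, longSet (projBound E) (W e)) ≤ m * q := by
    refine (measureReal_iUnion_fintype_le _).trans ?_
    refine (Finset.sum_le_sum fun e _ => measure_longSet_le (W e) hL).trans_eq ?_
    simp [hm, hq]
  have h2 : (sphereUniform E).real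
      (⋃ i : E × E, longSet (projBound E) (W i.1 - W i.2)) ≤ m * m * q := by
    refine (measureReal_iUnion_fintype_le _).trans ?_
    refine (Finset.sum_le_sum fun i _ => measure_longSet_le (W i.1 - W i.2) hL).trans_eq ?_
    simp [hm, hq]
  calc _ ≤ m * q + m * m * q := (measureReal_union_le _ _).trans (add_le_add h1 h2)
    _ ≤ 1 / (2 * m) := by
      rw [hqm, show m * (2 / m ^ 6) + m * m * (2 / m ^ 6) = (2 * m + 2 * m ^ 2) / m ^ 6 by ring,
        div_le_div_iff₀ (by positivity) (by positivity)]
      have h3 : 8 ≤ m ^ 3 := by nlinarith [sq_nonneg m]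
      have h4 : 4 * m ^ 2 + 4 * m ^ 3 ≤ m ^ 3 * m ^ 3 := by nlinarith [sq_nonneg m]
      nlinarith

/-- A lower bound for the progress of a round with random direction `x`, up to a factor. -/
noncomputable def gain (L : ℝ) (W : Matrix E E ℝ) (x : sphere (0 : EuclideanSpace ℝ E) 1) : ℝ :=
  ∑ e, proj (W e) x ^ 2 - (badSet L W).indicator (fun _ => ∑ e, ∑ h, W e h ^ 2) x

theorem measurable_gain (L : ℝ) (W : Matrix E E ℝ) : Measurable (gain L W) := by
  refine Measurable.sub ?_ (measurable_const.indicator (measurableSet_badSet L W))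
  exact (continuous_finsetSum _ fun e _ => (continuous_proj (W e)).pow 2).measurable

theorem gain_le_zero_of_mem {L : ℝ} {W : Matrix E E ℝ} {x : sphere (0 : EuclideanSpace ℝ E) 1}
    (hx : x ∈ badSet L W) : gain L W x ≤ 0 := by
  rw [gain, Set.indicator_of_mem hx, sub_nonpos]
  exact Finset.sum_le_sum fun e _ => proj_sq_le _ _

theorem abs_gain_le (L : ℝ) (W : Matrix E E ℝ) (x : sphere (0 : EuclideanSpace ℝ E) 1) :
    |gain L W x| ≤ ∑ e, ∑ h, W e h ^ 2 := by
  have h1 : ∑ e, proj (W e) x ^ 2 ≤ ∑ e, ∑ h, W e h ^ 2 :=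
    Finset.sum_le_sum fun e _ => proj_sq_le _ _
  have h2 : 0 ≤ ∑ e, proj (W e) x ^ 2 := by positivity
  have h3 : 0 ≤ ∑ e, ∑ h, W e h ^ 2 := by positivity
  rw [gain, abs_le]
  by_cases hx : x ∈ badSet L W
  · rw [Set.indicator_of_mem hx]
    constructor <;> linarith
  · rw [Set.indicator_of_notMem hx]
    constructor <;> linarith

/-- The projections contribute $1/m$ of the total squared length, and the bad set takes away at most
half of this. -/
theorem le_integral_gain (hE : 2 ≤ Fintype.card E) (W : Matrix E E ℝ) :
    (∑ e, ∑ h, W e h ^ 2) / (2 * Fintype.card E) ≤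
      ∫ x, gain (projBound E) W x ∂sphereUniform E := by
  have hne : Nonempty E := Fintype.card_pos_iff.1 (by omega)
  have hm : (0 : ℝ) < Fintype.card E := by exact_mod_cast Fintype.card_pos
  have hi : ∀ e, Integrable (fun x => proj (W e) x ^ 2) (sphereUniform E) := fun e =>
    integrable_of_continuous_sphere ((continuous_proj (W e)).pow 2)
  have hb := measurableSet_badSet (projBound E) W
  have hS : 0 ≤ ∑ e, ∑ h, W e h ^ 2 := by positivity
  unfold gain
  rw [integral_sub (integrable_finsetSum _ fun e _ => hi e)
    ((integrable_const _).indicator hb), integral_finsetSum _ fun e _ => hi e,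
    integral_indicator_const _ hb, smul_eq_mul]
  simp only [integral_proj_sq, ← Finset.sum_div]
  have := mul_le_mul_of_nonneg_right (measure_badSet_le hE W) hS
  calc (∑ e, ∑ h, W e h ^ 2) / (2 * Fintype.card E) =
      (∑ e, ∑ h, W e h ^ 2) / Fintype.card E
        - 1 / (2 * Fintype.card E) * ∑ e, ∑ h, W e h ^ 2 := by
        field_simp
        ring
    _ ≤ _ := by linarith

end Projections

/-! ### One round: from projections to the decrease of the potential. -/

section Round

open Metric

variable {V E : Type*} [DecidableEq V] [Fintype E] [DecidableEq E]

theorem splitNodes_sdiff (A S : Finset (V ⊕ E)) :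
    splitNodes (A \ S) = splitNodes A \ splitNodes S := by
  ext e
  simp [splitNodes]

/-- One round of the algorithm, from the point of view of the potential. -/
theorem IsRound.potential_le {G : Multigraph V E} {c : ℝ} {k : ℕ} (hk : 1 ≤ k)
    {A A' : Finset (V ⊕ E)} {F : Matrix E E ℝ} (hF : F.transpose = F)
    {r : sphere (0 : EuclideanSpace ℝ E) 1} {σ : Equiv.Perm E} {L : ℝ} (hL : 0 < L)
    (h : IsRound G c (2 ^ k) A F r A' σ) :
    potential (2 ^ k) (splitNodes A') (lazyMatrix (2 ^ k) σ * F * lazyMatrix (2 ^ k) σ) +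
      1 / (5760 * L) * gain L (walkMatrix (2 ^ k) (splitNodes A) F) r ≤
      potential (2 ^ k) (splitNodes A) F := by
  obtain ⟨Al, Ar, S, ⟨hAl, hAr, -, η, hη, -, -, h9, h80⟩, ⟨-, -, hσ, hmatch, hmoved, -⟩, rfl⟩ := h
  rw [splitNodes_sdiff]
  set X := splitNodes A
  set Y := splitNodes S
  set W := walkMatrix (2 ^ k) X F with hW
  have hpair : ∀ e ∈ Al \ Y, e ∈ X \ Y ∧ σ e ∈ X \ Y := fun e he =>
    ⟨Finset.sdiff_subset_sdiff hAl subset_rfl he,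
      Finset.sdiff_subset_sdiff hAr subset_rfl (hmatch e he)⟩
  -- A moved node belongs to a matched pair, both ends of which survive; all other nodes are fixed.
  have hinv : ∀ e, σ e ∈ X \ Y ↔ e ∈ X \ Y := by
    intro e
    by_cases he : σ e = e
    · rw [he]
    · rcases hmoved e he with h | h
      · exact iff_of_true (hpair e h).2 (hpair e h).1
      · have := hpair _ h
        rw [hσ] at this
        exact iff_of_true this.1 this.2
  have hdrop := potential_drop hk (A := X) Finset.sdiff_subset hσ hinv hF
  rw [← hW] at hdrop
  set D1 := ∑ e ∈ X \ Y, ∑ h, (W e h - W (σ e) h) ^ 2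
  set D2 := ∑ e ∈ (X \ Y)ᶜ, ∑ h, W e h ^ 2
  have hD1 : 0 ≤ D1 := by positivity
  have hD2 : 0 ≤ D2 := by positivity
  by_cases hbad : r ∈ badSet L W
  · have h1 : 1 / (5760 * L) * gain L W r ≤ 0 :=
      mul_nonpos_of_nonneg_of_nonpos (by positivity) (gain_le_zero_of_mem hbad)
    linarith
  have hgain : gain L W r = ∑ e ∈ X, proj (W e) r ^ 2 := by
    rw [gain, Set.indicator_of_notMem hbad, sub_zero]
    refine (Finset.sum_subset X.subset_univ fun e _ he => ?_).symm
    simp [proj, hW, walkMatrix_apply_of_notMem (by positivity : 2 ^ k ≠ 0) he]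
  simp only [badSet, longSet, Set.mem_union, Set.mem_iUnion, Set.mem_ofPred_eq, not_or, not_exists,
    not_lt] at hbad
  obtain ⟨hrow, hdiff⟩ := hbad
  have h80' : 1 / 80 * ∑ e ∈ X, proj (W e) r ^ 2 ≤ ∑ e ∈ Al, proj (W e) r ^ 2 := h80
  -- The separator `η` lies between the projections of `e` and of its partner, so their difference
  -- is at least the distance from `e` to `η`, hence at least a third of the projection of `e` in
  -- absolute value.
  have hm : ∀ e ∈ Al \ Y, proj (W e) r ^ 2 ≤ 9 * L * ∑ h, (W e h - W (σ e) h) ^ 2 := by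
    intro e he
    have a1 : 1 / 9 * proj (W e) r ^ 2 ≤ (proj (W e) r - η) ^ 2 := h9 e (Finset.sdiff_subset he)
    have a2 := hdiff (e, σ e)
    rw [proj_sub] at a2
    have a3 : (proj (W e) r - η) ^ 2 ≤ (proj (W e) r - proj (W (σ e)) r) ^ 2 := by
      rcases hη with ⟨b1, b2⟩ | ⟨b1, b2⟩
      · have c1 : proj (W e) r ≤ η := b1 e (Finset.sdiff_subset he)
        have c2 : η ≤ proj (W (σ e)) r := b2 _ (Finset.sdiff_subset (hmatch e he))
        nlinarith
      · have c1 : η ≤ proj (W e) r := b1 e (Finset.sdiff_subset he)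
        have c2 : proj (W (σ e)) r ≤ η := b2 _ (Finset.sdiff_subset (hmatch e he))
        nlinarith
    simp only [Pi.sub_apply] at a2
    linarith
  have hs1 : ∑ e ∈ Al \ Y, proj (W e) r ^ 2 ≤ 9 * L * D1 := by
    refine (Finset.sum_le_sum hm).trans ?_
    rw [← Finset.mul_sum]
    refine mul_le_mul_of_nonneg_left ?_ (by positivity)
    exact Finset.sum_le_sum_of_subset_of_nonneg (fun e he => (hpair e he).1)
      fun _ _ _ => by positivity
  -- Source nodes deleted with the cut are not matched; they are paid for by the loss of their whole
  -- rows.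
  have hs2 : ∑ e ∈ Al ∩ Y, proj (W e) r ^ 2 ≤ L * D2 := by
    refine (Finset.sum_le_sum fun e _ => hrow e).trans ?_
    rw [← Finset.mul_sum]
    refine mul_le_mul_of_nonneg_left ?_ hL.le
    refine Finset.sum_le_sum_of_subset_of_nonneg (fun e he => ?_) fun _ _ _ => by positivity
    simp [(Finset.mem_inter.1 he).2]
  have hsum := Finset.sum_inter_add_sum_sdiff Al Y fun e => proj (W e) r ^ 2
  -- The constant is $5760=80\cdot9\cdot8$: the cut player's $\frac1{80}$ and $\frac19$, and the
  -- $\frac18$ of the potential drop.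
  have hfin : 1 / (5760 * L) * gain L W r ≤ 1 / 8 * D1 + D2 := by
    rw [hgain, one_div_mul_eq_div, div_le_iff₀ (by positivity)]
    nlinarith [mul_nonneg hL.le hD2]
  linarith

end Round
-- Averaging over an independent direction.
section Averaging

open MeasureTheory ProbabilityTheory

variable {Ω S : Type*} {m : MeasurableSpace Ω} [mΩ : MeasurableSpace Ω] {μ : Measure Ω} [IsProbabilityMeasure μ] [Finite S]

theorem integrable_comp_of_finite {s : Ω → S} (hs : ∀ a, MeasurableSet {ω | s ω = a}) (f : S → ℝ) :
    Measurable (fun ω => f (s ω)) ∧ Integrable (fun ω => f (s ω)) μ := by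
  have := Fintype.ofFinite S
  let _ : MeasurableSpace S := ⊤
  have hm : Measurable fun ω => f (s ω) :=
    measurable_from_top.comp (measurable_to_countable' fun a => hs a)
  refine ⟨hm, Integrable.of_bound hm.aestronglyMeasurable (∑ a, |f a|)
    (Filter.Eventually.of_forall fun ω => ?_)⟩
  exact Finset.single_le_sum (f := fun a => |f a|) (fun a _ => abs_nonneg _) (Finset.mem_univ (s ω))

/-- Averaging over a random variable `r` that is independent of a finite-valued `s`. -/
theorem integral_comp_of_indep {Y : Type*} [MeasurableSpace Y] (hm : m ≤ mΩ)
    {s : Ω → S} (hs : ∀ a, MeasurableSet[m] {ω | s ω = a}) {r : Ω → Y} (hr : Measurable r)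
    (hind : Indep (MeasurableSpace.comap r inferInstance) m μ) {f : S → Y → ℝ}
    (hf : ∀ a, Measurable (f a)) (hb : ∀ a, ∃ K, ∀ y, |f a y| ≤ K) :
    Integrable (fun ω => f (s ω) (r ω)) μ ∧
      ∫ ω, f (s ω) (r ω) ∂μ = ∫ ω, ∫ y, f (s ω) y ∂(μ.map r) ∂μ := by
  classical
  have := Fintype.ofFinite S
  have hs' : ∀ a, MeasurableSet {ω | s ω = a} := fun a => hm _ (hs a)
  -- Splitting by the finitely many values of `s` leaves products of an indicator known in the past
  -- and a function of `r`, so independence applies without conditional expectations.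
  have hdec : ∀ ω, f (s ω) (r ω) = ∑ a, (if s ω = a then (1 : ℝ) else 0) * f a (r ω) := by
    intro ω
    simp
  have hdec' : ∀ ω, ∫ y, f (s ω) y ∂(μ.map r) =
      ∑ a, (if s ω = a then (1 : ℝ) else 0) * ∫ y, f a y ∂(μ.map r) := by
    intro ω
    simp
  have hI1 : ∀ a, Measurable[m] fun ω => if s ω = a then (1 : ℝ) else 0 := fun a =>
    Measurable.ite (hs a) measurable_const measurable_const
  have hJ1 : ∀ a, Integrable (fun ω => if s ω = a then (1 : ℝ) else 0) μ := fun a =>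
    (integrable_comp_of_finite hs' fun b => if b = a then (1 : ℝ) else 0).2
  have hJ2 : ∀ a, Integrable (fun ω => f a (r ω)) μ := fun a => by
    obtain ⟨K, hK⟩ := hb a
    exact Integrable.of_bound ((hf a).comp hr).aestronglyMeasurable K
      (Filter.Eventually.of_forall fun ω => hK (r ω))
  have hindf : ∀ a, IndepFun (fun ω => if s ω = a then (1 : ℝ) else 0) (fun ω => f a (r ω)) μ := by
    intro a
    rw [IndepFun_iff_Indep]
    refine indep_of_indep_of_le_left (indep_of_indep_of_le_right hind.symm ?_) (hI1 a).comap_le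
    exact ((hf a).comp (comap_measurable r)).comap_le
  have hprod : ∀ a, Integrable (fun ω => (if s ω = a then (1 : ℝ) else 0) * f a (r ω)) μ := fun a =>
    (hindf a).integrable_mul (hJ1 a) (hJ2 a)
  simp only [hdec, hdec']
  refine ⟨integrable_finsetSum _ fun a _ => hprod a, ?_⟩
  rw [integral_finsetSum _ fun a _ => hprod a,
    integral_finsetSum _ fun a _ => (hJ1 a).mul_const _]
  refine Finset.sum_congr rfl fun a _ => ?_
  rw [integral_mul_const, integral_map hr.aemeasurable (hf a).aestronglyMeasurable]
  exact (hindf a).integral_mul_eq_mul_integral (hJ1 a).aestronglyMeasurable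
    (hJ2 a).aestronglyMeasurable

end Averaging

/-! ### Symmetry and locality of the flow matrix. -/

section FlowMatrix

variable {E : Type*} [Fintype E] [DecidableEq E]

theorem flowMatrix_congr (d : ℕ) {σ τ : ℕ → Equiv.Perm E} {t : ℕ} (h : ∀ s < t, σ s = τ s) :
    flowMatrix d σ t = flowMatrix d τ t := by
  induction t with
  | zero => rfl
  | succ t ih =>
    rw [flowMatrix, flowMatrix, h t t.lt_succ_self, ih fun s hs => h s (hs.trans t.lt_succ_self)]

theorem flowMatrix_transpose (d : ℕ) {σ : ℕ → Equiv.Perm E} {t : ℕ}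
    (h : ∀ s < t, ∀ e, σ s (σ s e) = e) : (flowMatrix d σ t).transpose = flowMatrix d σ t := by
  induction t with
  | zero => simp [flowMatrix]
  | succ t ih =>
    rw [flowMatrix, Matrix.transpose_mul, Matrix.transpose_mul,
      lazyMatrix_transpose d (h t t.lt_succ_self), ih fun s hs => h s (hs.trans t.lt_succ_self),
      Matrix.mul_assoc]

end FlowMatrix

/-! ### Histories of an execution and the expected potential. -/

section AlgorithmHistory

open MeasureTheory ProbabilityTheory Metric

variable {V E : Type*} [Fintype V] [DecidableEq V] [Fintype E] [DecidableEq E]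

/-- The history of the first `t` rounds: the remaining sets and the matchings. -/
abbrev History (V E : Type*) (t : ℕ) : Type _ :=
  (Fin (t + 1) → Finset (V ⊕ E)) × (Fin t → Equiv.Perm E)

namespace History

variable {t : ℕ}

/-- The flow matrix determined by a history. -/
noncomputable def flow (d : ℕ) (H : History V E t) : Matrix E E ℝ :=
  -- The padding by the identity from index `t` on is never read.
  flowMatrix d (fun n => if h : n < t then H.2 ⟨n, h⟩ else 1) t

/-- The walk matrix determined by a history. -/
noncomputable def walk (d : ℕ) (H : History V E t) : Matrix E E ℝ :=
  walkMatrix d (splitNodes (H.1 (Fin.last t))) (H.flow d)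

/-- The potential determined by a history. -/
noncomputable def pot (d : ℕ) (H : History V E t) : ℝ :=
  potential d (splitNodes (H.1 (Fin.last t))) (H.flow d)

end History

namespace Execution

variable {G : Multigraph V E} {φ Z : ℝ} {d T : ℕ} {Ω : Type*} [mΩ : MeasurableSpace Ω]
  {μ : Measure Ω} (X : Execution G φ Z d T μ)

/-- The history of the first `t` rounds of an execution. -/
def history (t : ℕ) (ω : Ω) : History V E t :=
  (fun i => X.A i ω, fun i => X.M i ω)

theorem measurableSet_history {t : ℕ} (ht : t ≤ T) (H : History V E t) :
    MeasurableSet[X.ℱ t] {ω | X.history t ω = H} := by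
  have : {ω | X.history t ω = H} =
      (⋂ i : Fin (t + 1), {ω | X.A i ω = H.1 i}) ∩ ⋂ i : Fin t, {ω | X.M i ω = H.2 i} := by
    ext ω
    simp [history, Prod.ext_iff, funext_iff]
  rw [this]
  refine MeasurableSet.inter (MeasurableSet.iInter fun i => ?_) (MeasurableSet.iInter fun i => ?_)
  · have hi : (i : ℕ) ≤ t := Nat.lt_succ_iff.1 i.2
    exact X.ℱ.mono hi _ (X.measurable_A i (hi.trans ht) _)
  · exact X.ℱ.mono i.2 _ (X.measurable_M i (i.2.trans_le ht) _)

theorem flow_history (t : ℕ) (ω : Ω) :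
    (X.history t ω).flow d = flowMatrix d (fun s => X.M s ω) t :=
  flowMatrix_congr d fun s hs => by simp [hs, history]

theorem pot_history (t : ℕ) (ω : Ω) : (X.history t ω).pot d = X.psi t ω := by
  rw [History.pot, flow_history]
  rfl

theorem walk_history (t : ℕ) (ω : Ω) :
    (X.history t ω).walk d =
      walkMatrix d (splitNodes (X.A t ω)) (flowMatrix d (fun s => X.M s ω) t) := by
  rw [History.walk, flow_history]
  rfl

theorem Reaches.isRound {X : Execution G φ Z d T μ} {t : ℕ} (ht : t < T) {ω : Ω}
    (h : X.Reaches (t + 1) ω) :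
    IsRound G (1 / (φ * Z)) d (X.A t ω) (flowMatrix d (fun s => X.M s ω) t) (X.r t ω)
      (X.A (t + 1) ω) (X.M t ω) :=
  X.round t ht ω fun s hs => h s (Nat.lt_succ_of_le hs)

theorem Reaches.mono {X : Execution G φ Z d T μ} {s t : ℕ} (hst : s ≤ t) {ω : Ω}
    (h : X.Reaches t ω) : X.Reaches s ω :=
  fun i hi => h i (hi.trans_le hst)

theorem Reaches.flow_transpose {X : Execution G φ Z d T μ} {t : ℕ} (ht : t ≤ T) {ω : Ω}
    (h : X.Reaches t ω) :
    (flowMatrix d (fun s => X.M s ω) t).transpose = flowMatrix d (fun s => X.M s ω) t := by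
  refine flowMatrix_transpose d fun s hs => ?_
  obtain ⟨_, _, _, -, ⟨-, -, hσ, -⟩, -⟩ := (h.mono hs).isRound (hs.trans_le ht)
  exact hσ

theorem Reaches.psi_eq {X : Execution G φ Z d T μ} {t : ℕ} (ht : t ≤ T) {ω : Ω}
    (h : X.Reaches t ω) : X.psi t ω = ∑ e, ∑ h, (X.history t ω).walk d e h ^ 2 := by
  rw [walk_history]
  exact potential_eq_sum _ _ (h.flow_transpose ht)

theorem Reaches.psi_nonneg {X : Execution G φ Z d T μ} {t : ℕ} (ht : t ≤ T) {ω : Ω}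
    (h : X.Reaches t ω) : 0 ≤ X.psi t ω := by
  rw [h.psi_eq ht]
  positivity

open Classical in
/-- The potential, replaced by `0` if the loop has been left. -/
noncomputable def activePsi (t : ℕ) (ω : Ω) : ℝ :=
  if X.Reaches t ω then X.psi t ω else 0

theorem activePsi_nonneg {t : ℕ} (ht : t ≤ T) (ω : Ω) : 0 ≤ X.activePsi t ω := by
  rw [activePsi]
  split_ifs with h
  · exact h.psi_nonneg ht
  · rfl

theorem reaches_iff_history (t : ℕ) (ω : Ω) :
    X.Reaches t ω ↔ ∀ i : Fin t, Continues G Z ((X.history t ω).1 i.castSucc) :=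
  ⟨fun h i => h i i.2, fun h i hi => h ⟨i, hi⟩⟩

/-- Whether the next round is made is decided by the present history, before the next direction is
drawn. -/
theorem reaches_succ_iff_history (t : ℕ) (ω : Ω) :
    X.Reaches (t + 1) ω ↔ ∀ i, Continues G Z ((X.history t ω).1 i) :=
  ⟨fun h i => h i i.2, fun h i hi => h ⟨i, hi⟩⟩

variable [IsProbabilityMeasure μ]

theorem integrable_activePsi {t : ℕ} (ht : t ≤ T) :
    Measurable (X.activePsi t) ∧ Integrable (X.activePsi t) μ := by
  classical
  have h := integrable_comp_of_finite (μ := μ)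
    (fun H => X.ℱ.le t _ (X.measurableSet_history ht H))
    fun H => if ∀ i : Fin t, Continues G Z (H.1 i.castSucc) then H.pot d else 0
  have e : X.activePsi t = fun ω =>
      if ∀ i : Fin t, Continues G Z ((X.history t ω).1 i.castSucc)
      then (X.history t ω).pot d else 0 := by
    funext ω
    rw [activePsi, pot_history]
    exact if_congr (X.reaches_iff_history t ω) rfl rfl
  rwa [e]

/-- The rate is $\frac1{5760L}\cdot\frac1{2m}$ with $L=24\log m/m$, where $1/(2m)$ is the mean gain
relative to the potential. -/
theorem integral_activePsi_succ_le {k : ℕ} (hk : 1 ≤ k) (hd : d = 2 ^ k)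
    (hE : 2 ≤ Fintype.card E) {t : ℕ} (ht : t < T) :
    ∫ ω, X.activePsi (t + 1) ω ∂μ ≤
      Real.exp (-(1 / (276480 * Real.log (Fintype.card E)))) * ∫ ω, X.activePsi t ω ∂μ := by
  classical
  subst hd
  set m : ℝ := (Fintype.card E : ℝ) with hm
  have hm2 : (2 : ℝ) ≤ m := by rw [hm]; exact_mod_cast hE
  have hlog : 0 < Real.log m := Real.log_pos (by linarith)
  have hne : Nonempty E := Fintype.card_pos_iff.1 (by omega)
  set L := projBound E
  have hLm : L = 24 * Real.log m / m := rfl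
  have hL : 0 < L := by rw [hLm]; positivity
  have hexp : 1 - 1 / (276480 * Real.log m) ≤ Real.exp (-(1 / (276480 * Real.log m))) := by
    have := Real.add_one_le_exp (-(1 / (276480 * Real.log m)))
    linarith
  have hδ : 1 / (5760 * L) * (1 / (2 * m)) = 1 / (276480 * Real.log m) := by
    rw [hLm]
    field_simp
    norm_num
  -- This majorant of the next potential depends only on the history and the direction. The players'
  -- choices, which may depend on the direction and on further randomness, no longer occur in it.
  let f : History V E t → sphere (0 : EuclideanSpace ℝ E) 1 → ℝ := fun H x =>
    if ∀ i, Continues G Z (H.1 i) then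
      H.pot (2 ^ k) - 1 / (5760 * L) * gain L (H.walk (2 ^ k)) x else 0
  have hf : ∀ H, Measurable (f H) := by
    intro H
    by_cases h : ∀ i, Continues G Z (H.1 i)
    · simp only [f, h, implies_true, if_true]
      exact measurable_const.sub ((measurable_gain _ _).const_mul _)
    · simp only [f, h, if_false]
      exact measurable_const
  have hb : ∀ H, ∃ K, ∀ y, |f H y| ≤ K := by
    intro H
    refine ⟨|H.pot (2 ^ k)| +
      1 / (5760 * L) * ∑ e, ∑ h, H.walk (2 ^ k) e h ^ 2, fun y => ?_⟩
    have h0 : 0 ≤ 1 / (5760 * L) * ∑ e, ∑ h, H.walk (2 ^ k) e h ^ 2 := by positivity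
    simp only [f]
    split_ifs
    · refine (abs_sub _ _).trans (add_le_add le_rfl ?_)
      rw [abs_mul, abs_of_nonneg (by positivity : 0 ≤ 1 / (5760 * L))]
      exact mul_le_mul_of_nonneg_left (abs_gain_le _ _ _) (by positivity)
    · rw [abs_zero]
      positivity
  have hr : Measurable (X.r t) := (X.measurable_r t ht).mono (X.ℱ.le _) le_rfl
  obtain ⟨hint, heq⟩ := integral_comp_of_indep (X.ℱ.le t) (X.measurableSet_history ht.le) hr
    (X.indep_r t ht) hf hb
  rw [X.law_r t ht] at heq
  have hstep : ∀ ω, X.activePsi (t + 1) ω ≤ f (X.history t ω) (X.r t ω) := by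
    intro ω
    by_cases h : X.Reaches (t + 1) ω
    · have hc := (X.reaches_succ_iff_history t ω).1 h
      simp only [activePsi, f, h, if_true, hc, implies_true]
      rw [pot_history, walk_history]
      have := (h.isRound ht).potential_le hk ((h.mono t.le_succ).flow_transpose ht.le) hL
      have e : X.psi (t + 1) ω = potential (2 ^ k) (splitNodes (X.A (t + 1) ω))
        (lazyMatrix (2 ^ k) (X.M t ω) * flowMatrix (2 ^ k) (fun s => X.M s ω) t *
          lazyMatrix (2 ^ k) (X.M t ω)) := rfl
      have e' : X.psi t ω = potential (2 ^ k) (splitNodes (X.A t ω))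
        (flowMatrix (2 ^ k) (fun s => X.M s ω) t) := rfl
      rw [e, e']
      linarith
    · have hc : ¬ ∀ i, Continues G Z ((X.history t ω).1 i) := fun h' =>
        h ((X.reaches_succ_iff_history t ω).2 h')
      simp [activePsi, f, h, hc]
  have havg : ∀ ω, ∫ x, f (X.history t ω) x ∂sphereUniform E ≤
      Real.exp (-(1 / (276480 * Real.log m))) * X.activePsi t ω := by
    intro ω
    by_cases h : X.Reaches (t + 1) ω
    · have hc := (X.reaches_succ_iff_history t ω).1 h
      have h' := h.mono t.le_succ
      have hpsi := h'.psi_nonneg ht.le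
      simp only [activePsi, f, h', if_true, hc, implies_true]
      have hgi : Integrable (gain L ((X.history t ω).walk (2 ^ k))) (sphereUniform E) :=
        Integrable.of_bound (measurable_gain _ _).aestronglyMeasurable _
          (Filter.Eventually.of_forall fun x => abs_gain_le _ _ x)
      rw [integral_sub (integrable_const _) (hgi.const_mul _), integral_const_mul, integral_const,
        pot_history]
      have hg := le_integral_gain hE ((X.history t ω).walk (2 ^ k))
      rw [← h'.psi_eq ht.le, ← hm] at hg
      have hg' := mul_le_mul_of_nonneg_left hg (by positivity : 0 ≤ 1 / (5760 * L))
      have e : 1 / (5760 * L) * (X.psi t ω / (2 * m)) =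
          1 / (276480 * Real.log m) * X.psi t ω := by
        rw [← hδ]
        ring
      rw [e] at hg'
      simp only [probReal_univ, one_smul]
      have := mul_le_mul_of_nonneg_right hexp hpsi
      linarith
    -- If the loop is left now, the majorant is zero, while `activePsi t` is still nonnegative.
    · have hc : ¬ ∀ i, Continues G Z ((X.history t ω).1 i) := fun h' =>
        h ((X.reaches_succ_iff_history t ω).2 h')
      simp only [f, hc, if_false, integral_zero]
      exact mul_nonneg (Real.exp_pos _).le (X.activePsi_nonneg ht.le ω)
  have hfin := (integrable_comp_of_finite (μ := μ)
    (fun H => X.ℱ.le t _ (X.measurableSet_history ht.le H))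
    fun H => ∫ x, f H x ∂sphereUniform E).2
  calc ∫ ω, X.activePsi (t + 1) ω ∂μ
      ≤ ∫ ω, f (X.history t ω) (X.r t ω) ∂μ :=
        integral_mono (X.integrable_activePsi (Nat.succ_le_of_lt ht)).2 hint hstep
    _ = ∫ ω, ∫ x, f (X.history t ω) x ∂sphereUniform E ∂μ := heq
    _ ≤ ∫ ω, Real.exp (-(1 / (276480 * Real.log m))) * X.activePsi t ω ∂μ :=
        integral_mono hfin ((X.integrable_activePsi ht.le).2.const_mul _) havg
    _ = _ := integral_const_mul _ _

theorem integral_activePsi_le {k : ℕ} (hk : 1 ≤ k) (hd : d = 2 ^ k)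
    (hE : 2 ≤ Fintype.card E) {t : ℕ} (ht : t ≤ T) :
    ∫ ω, X.activePsi t ω ∂μ ≤
      Real.exp (-(t / (276480 * Real.log (Fintype.card E)))) * Fintype.card E := by
  induction t with
  | zero =>
    have h : ∀ ω, X.activePsi 0 ω ≤ Fintype.card E := by
      intro ω
      have : X.Reaches 0 ω := fun s hs => absurd hs (Nat.not_lt_zero s)
      simp only [activePsi, this, if_true]
      exact potential_one_le (by rw [hd]; positivity) _
    refine (integral_mono (X.integrable_activePsi ht).2 (integrable_const _) h).trans_eq ?_
    simp
  | succ t ih =>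
    refine (X.integral_activePsi_succ_le hk hd hE ht).trans ?_
    refine (mul_le_mul_of_nonneg_left (ih (Nat.le_of_succ_le ht)) (Real.exp_pos _).le).trans_eq ?_
    rw [← mul_assoc, ← Real.exp_add]
    congr 2
    push_cast
    ring

end Execution
end AlgorithmHistory
end CutMatching

/-! ### The high-probability bound. -/

theorem mainTheorem5 (l p : ℝ) (hl : 0 < l) (hp : 0 < p) :
    ∃ C : ℝ, 0 < C ∧
      ∀ (V E Ω : Type*) [Fintype V] [DecidableEq V] [Fintype E] [DecidableEq E]
        (G : CutMatching.Multigraph V E) (φ Z : ℝ) (d T : ℕ)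
        [MeasurableSpace Ω] (μ : MeasureTheory.Measure Ω)
        [MeasureTheory.IsProbabilityMeasure μ]
        (X : CutMatching.Execution G φ Z d T μ),
        2 ≤ Fintype.card E → 0 < φ → 0 < Z → (∃ k : ℕ, 1 ≤ k ∧ d = 2 ^ k) →
        C * Real.log (Fintype.card E) ^ 2 ≤ T →
        1 - (Fintype.card E : ℝ) ^ (-p) ≤
          μ.real {ω | X.Reaches T ω → X.psi T ω ≤ (Fintype.card E : ℝ) ^ (-l)} := by
  -- The number $276480$ cancels the rate per round; of the exponent, $l$ is the target, $p$ pays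
  -- for Markov's inequality and $1$ for the initial potential, at most $m$.
  refine ⟨276480 * (l + p + 1), by positivity, ?_⟩
  intro V E Ω _ _ _ _ G φ Z d T _ μ _ X hE _ _ ⟨k, hk, hd⟩ hT
  set m : ℝ := (Fintype.card E : ℝ) with hm
  have hm2 : (2 : ℝ) ≤ m := by rw [hm]; exact_mod_cast hE
  have hm0 : 0 < m := by linarith
  have hlog : 0 < Real.log m := Real.log_pos (by linarith)
  obtain ⟨hmeas, hint⟩ := X.integrable_activePsi le_rfl
  have hmean : ∫ ω, X.activePsi T ω ∂μ ≤ m ^ (-(l + p + 1)) * m := by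
    refine (X.integral_activePsi_le hk hd hE le_rfl).trans ?_
    rw [← hm, Real.rpow_def_of_pos hm0]
    refine mul_le_mul_of_nonneg_right (Real.exp_le_exp.2 ?_) hm0.le
    rw [mul_neg, neg_le_neg_iff, le_div_iff₀ (by positivity)]
    linarith
  have hmarkov := MeasureTheory.mul_meas_ge_le_integral_of_nonneg
    (Filter.Eventually.of_forall fun ω => X.activePsi_nonneg le_rfl ω) hint (m ^ (-l))
  have hbad : μ.real {ω | m ^ (-l) ≤ X.activePsi T ω} ≤ m ^ (-p) := by
    have h1 : m ^ (-(l + p + 1)) * m = m ^ (-l) * m ^ (-p) := by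
      rw [← Real.rpow_add hm0]
      nth_rewrite 2 [← Real.rpow_one m]
      rw [← Real.rpow_add hm0]
      congr 1
      ring
    rw [h1] at hmean
    exact le_of_mul_le_mul_left (hmarkov.trans hmean) (Real.rpow_pos_of_pos hm0 _)
  have hset : MeasurableSet {ω | m ^ (-l) ≤ X.activePsi T ω} :=
    measurableSet_le measurable_const hmeas
  calc 1 - m ^ (-p) ≤ 1 - μ.real {ω | m ^ (-l) ≤ X.activePsi T ω} := by linarith
    _ = μ.real {ω | m ^ (-l) ≤ X.activePsi T ω}ᶜ :=
        (MeasureTheory.probReal_compl_eq_one_sub hset).symm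
    _ ≤ _ := by
      refine MeasureTheory.measureReal_mono fun ω hω hr => ?_
      -- Where all `T` rounds are made, `activePsi` is the true potential; elsewhere nothing is
      -- claimed.
      have : ¬ m ^ (-l) ≤ X.activePsi T ω := hω
      simp only [CutMatching.Execution.activePsi, hr, if_true] at this
      exact (not_le.1 this).le
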